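/- For a group $H$, let $b_1(H)$ denote the rank of the free part of the abelianization $H/[H,H]$. For a finitely generated group $G$, let $\Lambda_G$ be the set of subgroups of finite index of $G$, directed by reverse inclusion, and define the Betti volume of $G$ by $$V_b(G)=\limsup_{H\in\Lambda_G}\frac{b_1(H)-1}{[G:H]}=\inf_{H\in\Lambda_G}\ \sup_{K\in\Lambda_G,\,K\le H}\frac{b_1(K)-1}{[G:K]}.$$ Let $(\mathcal G,Y)$ be a graph of groups over a finite connected graph $Y$ (loops and multiple edges allowed), with vertex set $VY\neq\emptyset$ and set $EY$ of geometric (unoriented) edges, with vertex groups $G_u$ ($u\in VY$) and edge groups $G_e$ ($e\in EY$). Assume that every vertex group is finitely generated, that every edge group is finite, and that each vertex group is residually finite or virtually torsion free (that is, has a torsion-free subgroup of finite index). Let $G$ be the fundamental group of $(\mathcal G,Y)$, i.e. $G=\pi_1(\mathcal G,Y,T)$ for a spanning tree $T$ of $Y$. Then $$V_b(G)=\sum_{u\in VY}V_b(G_u)+\sum_{e\in EY}\frac{1}{|G_e|}.$$ -/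

import Mathlib

noncomputable section

/-! ### The Betti volume of a group -/

/-- A group is virtually torsion free if it has a subgroup of finite index whose only element of
finite order is the identity. -/
def IsVirtuallyTorsionFree (G : Type*) [Group G] : Prop :=
  ∃ H : Subgroup G, H.FiniteIndex ∧ ∀ g ∈ H, IsOfFinOrder g → g = 1

/-- The first Betti number of a (finitely generated) group: the rank of the free part of its
abelianization, that is, the maximal number of `ℤ`-linearly independent elements of it. -/
def firstBetti (G : Type*) [Group G] : ℕ :=
  Module.finrank ℤ (Additive (Abelianization G))

/-- The subgroups of finite index of `G`, ordered by inclusion. -/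
abbrev FinIndexSubgroup (G : Type*) [Group G] : Type _ :=
  {H : Subgroup G // H.FiniteIndex}

instance FinIndexSubgroup.instIsDirected (G : Type*) [Group G] :
    IsCodirectedOrder (FinIndexSubgroup G) :=
  ⟨fun H K => ⟨⟨H.1 ⊓ K.1, by have := H.2; have := K.2; infer_instance⟩,
    (inf_le_left : H.1 ⊓ K.1 ≤ H.1), (inf_le_right : H.1 ⊓ K.1 ≤ K.1)⟩⟩

instance FinIndexSubgroup.instNonempty (G : Type*) [Group G] : Nonempty (FinIndexSubgroup G) :=
  ⟨⟨⊤, inferInstance⟩⟩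

/-- The quotient `(b₁(H) - 1) / [G : H]`. -/
def bettiRatio (G : Type*) [Group G] (H : FinIndexSubgroup G) : ℝ :=
  ((firstBetti H.1 : ℝ) - 1) / (H.1.index : ℝ)

/-- The Betti volume of a (finitely generated) group `G`: the upper limit of
`(b₁(H) - 1) / [G : H]` over the net of the subgroups `H` of finite index of `G`, directed by
reverse inclusion. For a finitely generated `G` this net is bounded, see `abs_bettiRatio_le`. -/
def bettiVolume (G : Type*) [Group G] : ℝ :=
  Filter.limsup (bettiRatio G) Filter.atBot

theorem firstBetti_le_rank (G : Type*) [Group G] [Group.FG G] : firstBetti G ≤ Group.rank G := by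
  obtain ⟨S, hS, hcl⟩ := Group.rank_spec G
  rw [← hS]
  have hspan : (⊤ : Submodule ℤ (Additive (Abelianization G))) ≤ Submodule.span ℤ
      (Set.range fun s : S => Additive.ofMul (Abelianization.of (s : G))) := by
    rintro x -
    obtain ⟨g, hg⟩ := QuotientGroup.mk_surjective (s := commutator G) (Additive.toMul x)
    have key : ∀ g ∈ Subgroup.closure (S : Set G), Additive.ofMul (Abelianization.of g) ∈
        Submodule.span ℤ
          (Set.range fun s : S => Additive.ofMul (Abelianization.of (s : G))) := by
      intro g hg
      induction hg using Subgroup.closure_induction with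
      | mem y hy => exact Submodule.subset_span ⟨⟨y, hy⟩, rfl⟩
      | one => simp
      | mul y z _ _ hy hz =>
        rw [map_mul, ofMul_mul]
        exact Submodule.add_mem _ hy hz
      | inv y _ hy =>
        rw [map_inv, ofMul_inv]
        exact Submodule.neg_mem _ hy
    have hx : x = Additive.ofMul (Abelianization.of g) := by
      change x = Additive.ofMul (QuotientGroup.mk g)
      rw [hg]; rfl
    rw [hx]
    exact key g (hcl ▸ Subgroup.mem_top g)
  have h := finrank_le_of_span_eq_top (R := ℤ) (top_le_iff.1 hspan)
  simpa [firstBetti] using h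

/-- The net in the definition of the Betti volume is bounded when `G` is finitely generated. -/
theorem abs_bettiRatio_le (G : Type*) [Group G] [Group.FG G] (H : FinIndexSubgroup G) :
    |bettiRatio G H| ≤ Group.rank G + 1 := by
  have := H.2
  have h0 : (1 : ℝ) ≤ H.1.index := by
    exact_mod_cast Nat.one_le_iff_ne_zero.2 Subgroup.FiniteIndex.index_ne_zero
  have h1 : (firstBetti H.1 : ℝ) ≤ H.1.index * Group.rank G := by
    exact_mod_cast (firstBetti_le_rank H.1).trans (Subgroup.rank_le_index_mul_rank H.1)
  have h2 : (0 : ℝ) ≤ firstBetti H.1 := Nat.cast_nonneg _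
  have h3 : (0 : ℝ) ≤ Group.rank G := Nat.cast_nonneg _
  rw [bettiRatio, abs_div, abs_of_pos (by linarith : (0 : ℝ) < H.1.index),
    div_le_iff₀ (by linarith), abs_le]
  constructor <;> nlinarith

/-! ### Graphs of groups and their fundamental groups -/

universe u v w x

/-- A graph of groups, with vertex set `V` and set of geometric edges `E`. The underlying graph is
a multigraph (loops and multiple edges are allowed) in which an orientation of the edges has been
chosen, so every geometric edge occurs exactly once in `E`. Each edge group is embedded in the
groups of the two endpoints of the edge. -/
structure GraphOfGroups (V : Type u) (E : Type v) where
  /-- The initial vertex of an edge. -/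
  src : E → V
  /-- The terminal vertex of an edge. -/
  tgt : E → V
  /-- The vertex groups. -/
  vertexGroup : V → Type w
  [instVertexGroup : ∀ u, Group (vertexGroup u)]
  /-- The edge groups. -/
  edgeGroup : E → Type x
  [instEdgeGroup : ∀ e, Group (edgeGroup e)]
  /-- The monomorphism from an edge group to the group of the initial vertex. -/
  toSrc : ∀ e, edgeGroup e →* vertexGroup (src e)
  /-- The monomorphism from an edge group to the group of the terminal vertex. -/
  toTgt : ∀ e, edgeGroup e →* vertexGroup (tgt e)
  toSrc_injective : ∀ e, Function.Injective (toSrc e)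
  toTgt_injective : ∀ e, Function.Injective (toTgt e)

namespace GraphOfGroups

attribute [instance] GraphOfGroups.instVertexGroup GraphOfGroups.instEdgeGroup

variable {V : Type u} {E : Type v} (𝒢 : GraphOfGroups.{u, v, w, x} V E)

/-- The unordered pair of endpoints of an edge. -/
def ends (e : E) : Sym2 V := s(𝒢.src e, 𝒢.tgt e)

/-- A set `T` of edges is (the set of edges of) a spanning tree of the underlying graph if it has
no loops, no two edges with the same endpoints, and the simple graph which it then forms on
all the vertices is a tree. A graph has a spanning tree if and only if it is nonempty and
connected. -/
structure IsSpanningTree (T : Set E) : Prop where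
  not_loop : ∀ e ∈ T, ¬ (𝒢.ends e).IsDiag
  injOn_ends : Set.InjOn 𝒢.ends T
  isTree : (SimpleGraph.fromEdgeSet (𝒢.ends '' T)).IsTree

/-- The free product of all the vertex groups and of the free group on the edges. -/
abbrev PreGroup : Type (max u v w) :=
  Monoid.Coprod (Monoid.CoprodI 𝒢.vertexGroup) (FreeGroup E)

/-- The image of an element of a vertex group in the free product. -/
def preOf (u : V) : 𝒢.vertexGroup u →* 𝒢.PreGroup :=
  Monoid.Coprod.inl.comp Monoid.CoprodI.of

/-- The stable letter of an edge in the free product. -/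
def preT (e : E) : 𝒢.PreGroup := Monoid.Coprod.inr (FreeGroup.of e)

/-- The relators of the fundamental group with respect to `T`: for every edge `e` and every `a`
in its edge group the relation `t_e * a_tgt * t_e⁻¹ = a_src` between the stable letter and the
two images of `a`, and the relation `t_e = 1` for every edge `e` in `T`. -/
def relators (T : Set E) : Set 𝒢.PreGroup :=
  {r | ∃ (e : E) (a : 𝒢.edgeGroup e),
      r = 𝒢.preT e * 𝒢.preOf (𝒢.tgt e) (𝒢.toTgt e a) * (𝒢.preT e)⁻¹ *
        (𝒢.preOf (𝒢.src e) (𝒢.toSrc e a))⁻¹} ∪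
  {r | ∃ e ∈ T, r = 𝒢.preT e}

/-- The fundamental group of a graph of groups with respect to a spanning tree `T`. -/
abbrev FundamentalGroup (T : Set E) : Type (max u v w) :=
  𝒢.PreGroup ⧸ Subgroup.normalClosure (𝒢.relators T)

end GraphOfGroups

end

/-!
For a group `H` acting on a finite set `X`, the dimension of the space of crossed homomorphisms
`H → ℚ^X` minus `|X|` equals, by Shapiro's lemma, the sum over `X` of `(b₁(K) - 1) / [H : K]`,
where `K` is the stabilizer of the point. A crossed homomorphism on the fundamental group `G` of a
graph of groups is a family of crossed homomorphisms on the vertex groups together with values on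
the stable letters, subject to the relations of `G`. When the edge groups are finite these linear
conditions are independent, so the excess of `G` is the sum of those of the vertex groups minus
the sum of those of the edge groups. For `X = G ⧸ K`, where the conjugates of `K` meet the edge
groups trivially, this says that `(b₁(K) - 1) / [G : K]` is the average, over conjugates `K'` of
`K`, of the sum of the corresponding quotients of the subgroups `K' ∩ G_u` of the `G_u` and of
all `1 / |G_e|`. This gives the upper bound. For the lower bound, finite actions of the vertex
groups in which the edge groups act freely can be glued to an action of `G`, because any two free
actions of a finite group on a finite set are conjugate; hence the `K' ∩ G_u` can be prescribed
up to conjugacy.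
-/

noncomputable section

universe u v w x

open Module

section CrossedHoms

variable {k H A M N : Type*} [Group H] [Group A] [AddCommGroup M] [AddCommGroup N]

section CommRing

variable [CommRing k] [Module k M] [Module k N]

/-- The crossed homomorphisms (inhomogeneous 1-cocycles) of a group with values in a linear
representation. Mathlib's `groupCohomology.cocycles₁` would require the ring and the group to live
in the same universe. -/
def crossedHoms (ρ : Representation k H M) : Submodule k (H → M) where
  carrier := {f | ∀ g h, f (g * h) = f g + ρ g (f h)}
  add_mem' hf hf' g h := by simp only [Pi.add_apply, hf g h, hf' g h, map_add]; abel
  zero_mem' _ _ := by simp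
  smul_mem' c f hf g h := by simp only [Pi.smul_apply, hf g h, smul_add, map_smul]

namespace crossedHoms

variable {ρ : Representation k H M}

instance : FunLike (crossedHoms ρ) H M where
  coe := Subtype.val
  coe_injective := Subtype.val_injective

@[ext]
theorem ext {f f' : crossedHoms ρ} (h : ∀ g, f g = f' g) : f = f' :=
  DFunLike.ext _ _ h

theorem apply_mul (f : crossedHoms ρ) (g h : H) : f (g * h) = f g + ρ g (f h) :=
  f.2 g h

theorem apply_one (f : crossedHoms ρ) : f 1 = 0 := by
  simpa using apply_mul f 1 1

theorem apply_inv (f : crossedHoms ρ) (g : H) : f g⁻¹ = -ρ g⁻¹ (f g) := by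
  rw [eq_neg_iff_add_eq_zero, ← apply_mul, inv_mul_cancel, apply_one]

theorem eqOn_closure {f f' : crossedHoms ρ} {S : Set H} (h : Set.EqOn f f' S) :
    Set.EqOn f f' (Subgroup.closure S) := by
  intro g hg
  induction hg using Subgroup.closure_induction with
  | mem g hg => exact h hg
  | one => rw [apply_one, apply_one]
  | mul g g' _ _ hg hg' => rw [apply_mul, apply_mul, hg, hg']
  | inv g _ hg => rw [apply_inv, apply_inv, hg]

instance [IsNoetherianRing k] [Group.FG H] [Module.Finite k M] :
    Module.Finite k (crossedHoms ρ) := by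
  obtain ⟨S, hS⟩ := Group.fg_def.1 ‹Group.FG H›
  let restrictToS : crossedHoms ρ →ₗ[k] (S → M) :=
    LinearMap.funLeft k M (Subtype.val : S → H) ∘ₗ (crossedHoms ρ).subtype
  refine Module.Finite.of_injective restrictToS fun f f' h => ext fun g => ?_
  exact eqOn_closure (fun s hs => congrFun h ⟨s, hs⟩) (hS ▸ Subgroup.mem_top g)

/-- Restriction of crossed homomorphisms along a group homomorphism. -/
def comap (φ : A →* H) : crossedHoms ρ →ₗ[k] crossedHoms (ρ.comp φ) where
  toFun f := ⟨fun a => f (φ a), fun a b => by simp [apply_mul]⟩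
  map_add' _ _ := rfl
  map_smul' _ _ := rfl

/-- The map on crossed homomorphisms induced by an equivariant map of the coefficients. -/
def map {σ : Representation k H N} (L : M →ₗ[k] N) (hL : ∀ g m, L (ρ g m) = σ g (L m)) :
    crossedHoms ρ →ₗ[k] crossedHoms σ where
  toFun f := ⟨fun g => L (f g), fun g h => by simp [apply_mul, hL]⟩
  map_add' _ _ := ext fun _ => map_add L _ _
  map_smul' _ _ := ext fun _ => map_smul L _ _

@[simp]
theorem zero_apply (g : H) : (0 : crossedHoms ρ) g = 0 :=
  rfl

variable (ρ) in
/-- The principal crossed homomorphism `g ↦ ρ g m - m` of an element `m`. -/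
def coboundary : M →ₗ[k] crossedHoms ρ where
  toFun m := ⟨fun g => ρ g m - m, fun g h => by simp⟩
  map_add' m m' := ext fun g => by
    change ρ g (m + m') - (m + m') = (ρ g m - m) + (ρ g m' - m')
    rw [map_add, add_sub_add_comm]
  map_smul' c m := ext fun g => by
    change ρ g (c • m) - c • m = c • (ρ g m - m)
    rw [map_smul, smul_sub]

@[simp]
theorem coboundary_apply (m : M) (g : H) : coboundary ρ m g = ρ g m - m :=
  rfl

theorem ker_coboundary : LinearMap.ker (coboundary ρ) = ρ.invariants := by
  ext m
  simp [DFunLike.ext_iff, sub_eq_zero]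

/-- The action on the coefficients, in the form needed for the semidirect product. -/
def toMulAut (ρ : Representation k H M) : H →* MulAut (Multiplicative M) where
  toFun g :=
    { toFun := fun m => .ofAdd (ρ g m.toAdd)
      invFun := fun m => .ofAdd (ρ g⁻¹ m.toAdd)
      left_inv := fun m => by simp
      right_inv := fun m => by simp
      map_mul' := fun m m' => by simp }
  map_one' := by ext; simp
  map_mul' g h := by ext; simp

/-- The homomorphism `a ↦ (f a, φ a)` to the semidirect product defined by a crossed
homomorphism. -/
def toSemidirect {φ : A →* H} (f : crossedHoms (ρ.comp φ)) :
    A →* Multiplicative M ⋊[toMulAut ρ] H :=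
  MonoidHom.mk' (fun a => ⟨.ofAdd (f a), φ a⟩) fun a b =>
    SemidirectProduct.ext (congrArg Multiplicative.ofAdd (apply_mul f a b)) (φ.map_mul a b)

/-- The crossed homomorphism defined by a splitting of the semidirect product. -/
def ofSemidirect (Φ : H →* Multiplicative M ⋊[toMulAut ρ] H)
    (hΦ : ∀ g, (Φ g).right = g) : crossedHoms ρ :=
  ⟨fun g => (Φ g).left.toAdd, fun g h => by
    simp only [_root_.map_mul, SemidirectProduct.mul_left, hΦ, toAdd_mul]
    rfl⟩

end crossedHoms

end CommRing

namespace crossedHoms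

variable [Field k] [Module k M] (ρ : Representation k H M)

theorem coboundary_surjective [NeZero (Nat.card H : k)] :
    Function.Surjective (coboundary ρ) := by
  have hH : (Nat.card H : k) ≠ 0 := NeZero.ne _
  have : Finite H := Nat.finite_of_card_ne_zero fun h => hH (by rw [h, Nat.cast_zero])
  have := Fintype.ofFinite H
  intro f
  have sum_eq (g : H) : ∑ h, f h = (Nat.card H : k) • f g + ρ g (∑ h, f h) :=
    calc ∑ h, f h = ∑ h, f (g * h) := (Equiv.sum_comp (Equiv.mulLeft g) f).symm
      _ = ∑ h, (f g + ρ g (f h)) := by simp only [apply_mul]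
      _ = (Nat.card H : k) • f g + ρ g (∑ h, f h) := by
        rw [Finset.sum_add_distrib, Finset.sum_const, Finset.card_univ,
          ← Nat.card_eq_fintype_card, Nat.cast_smul_eq_nsmul, map_sum]
  refine ⟨-((Nat.card H : k)⁻¹ • ∑ h, f h), ext fun g => ?_⟩
  calc coboundary ρ (-((Nat.card H : k)⁻¹ • ∑ h, f h)) g
      = (Nat.card H : k)⁻¹ • (∑ h, f h - ρ g (∑ h, f h)) := by
        rw [coboundary_apply, map_neg, map_smul, neg_sub_neg, smul_sub]
    _ = f g := by rw [sub_eq_of_eq_add (sum_eq g), inv_smul_smul₀ hH]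

/-- The number `dim H¹(H, M) - dim H⁰(H, M)`, minus the Euler characteristic in degrees at most one.
By rank–nullity for `coboundary` it can be computed from the crossed homomorphisms alone. -/
def excess : ℝ :=
  finrank k (crossedHoms ρ) - finrank k M

variable {ρ}

theorem excess_eq_sum {ι : Type*} [Fintype ι] {N : ι → Type*} [∀ i, AddCommGroup (N i)]
    [∀ i, Module k (N i)] [∀ i, Module.Finite k (N i)] [Group.FG H]
    (σ : ∀ i, Representation k H (N i))
    (e : M ≃ₗ[k] ∀ i, N i) (he : ∀ g m i, e (ρ g m) i = σ i g (e m i)) :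
    excess ρ = ∑ i, excess (σ i) := by
  let split : crossedHoms ρ →ₗ[k] ∀ i, crossedHoms (σ i) :=
    LinearMap.pi fun i => map (LinearMap.proj i ∘ₗ e.toLinearMap) fun g m => he g m i
  have split_bijective : Function.Bijective split := by
    refine ⟨fun f f' h => ext fun g => e.injective (funext fun i =>
      DFunLike.congr_fun (congrFun h i) g), fun f => ⟨⟨fun g => e.symm fun i => f i g, ?_⟩, ?_⟩⟩
    · exact fun g h => e.injective (funext fun i => by simp [he, apply_mul])
    · exact funext fun i => ext fun g => congrFun (e.apply_symm_apply _) i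
  rw [excess, (LinearEquiv.ofBijective split split_bijective).finrank_eq, e.finrank_eq,
    finrank_pi_fintype, finrank_pi_fintype]
  simp only [excess, Nat.cast_sum, Finset.sum_sub_distrib]

end crossedHoms

end CrossedHoms

section FirstBetti

variable {G H : Type*} [Group G] [Group H]

theorem firstBetti_congr (e : G ≃* H) : firstBetti G = firstBetti H :=
  (MulEquiv.toAdditive e.abelianizationCongr).toIntLinearEquiv.finrank_eq

theorem firstBetti_of_subsingleton [Subsingleton G] : firstBetti G = 0 := by
  have : Subsingleton (Additive (Abelianization G)) := QuotientGroup.mk_surjective.subsingleton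
  exact Module.finrank_zero_of_subsingleton

open TensorProduct in
theorem finrank_addMonoidHom_rat (G : Type*) [Group G] :
    finrank ℚ (Additive G →+ ℚ) = firstBetti G := by
  let homEquiv : (Additive (Abelianization G) →ₗ[ℤ] ℚ) ≃ₗ[ℚ] (Additive G →+ ℚ) :=
    { toFun := fun f => f.toAddMonoidHom.comp (MonoidHom.toAdditive Abelianization.of)
      invFun := fun f => (MonoidHom.toAdditiveLeft
        (Abelianization.lift (AddMonoidHom.toMultiplicativeRight f))).toIntLinearMap
      map_add' := fun _ _ => rfl
      map_smul' := fun _ _ => rfl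
      left_inv := fun f => LinearMap.ext fun x =>
        (QuotientGroup.mk_surjective (s := commutator G) (Additive.toMul x)).elim
          fun y hy => by subst hy; rfl
      right_inv := fun _ => rfl }
  calc finrank ℚ (Additive G →+ ℚ)
      = finrank ℚ (Dual ℚ (ℚ ⊗[ℤ] Additive (Abelianization G))) :=
        (homEquiv.symm.trans (LinearMap.liftBaseChangeEquiv ℚ)).finrank_eq
    _ = finrank ℚ (ℚ ⊗[ℤ] Additive (Abelianization G)) := Subspace.dual_finrank_eq
    _ = firstBetti G := (TensorProduct.isBaseChange ℤ _ ℚ).finrank_eq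

end FirstBetti

section BettiQuotient

open Pointwise

variable {G : Type*} [Group G]

/-- The quotient `(b₁(K) - 1) / [G : K]`. If `K` has infinite index, its value is `0` by the
conventions for `Subgroup.index` and for division. -/
def bettiQuotient (K : Subgroup G) : ℝ :=
  ((firstBetti K : ℝ) - 1) / K.index

theorem bettiQuotient_bot : bettiQuotient (⊥ : Subgroup G) = -(1 / (Nat.card G : ℝ)) := by
  rw [bettiQuotient, firstBetti_of_subsingleton, Subgroup.index_bot, Nat.cast_zero, zero_sub,
    neg_div]

theorem index_conj_smul (g : G) (K : Subgroup G) : (MulAut.conj g • K).index = K.index :=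
  Subgroup.index_map_of_bijective (f := MulDistribMulAction.toMonoidEnd _ G (MulAut.conj g))
    (MulAut.conj g).bijective K

theorem bettiQuotient_conj_smul (g : G) (K : Subgroup G) :
    bettiQuotient (MulAut.conj g • K) = bettiQuotient K := by
  rw [bettiQuotient, bettiQuotient, ← firstBetti_congr (K.equivSMul (MulAut.conj g)),
    index_conj_smul]

end BettiQuotient

section PermutationRepresentation

namespace crossedHoms

variable (k H X : Type*) [Group H] [MulAction H X]

section CommRing

variable [CommRing k]

/-- The permutation representation on the functions on a set with an action. Unlike
`Representation.ofMulAction` it is made of functions of arbitrary support. -/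
def permRep : Representation k H (X → k) where
  toFun g := LinearMap.funLeft k k (g⁻¹ • ·)
  map_one' := by ext; simp [LinearMap.funLeft]
  map_mul' g h := by ext; simp [LinearMap.funLeft, mul_smul]

variable {k H X}

@[simp]
theorem permRep_apply (g : H) (n : X → k) (x : X) : permRep k H X g n x = n (g⁻¹ • x) :=
  rfl

theorem apply_mul_smul (f : crossedHoms (permRep k H X)) (g h : H) (x : X) :
    f (g * h) (g • x) = f g (g • x) + f h x := by
  simp [apply_mul]

/-- The map of Shapiro's lemma from the crossed homomorphisms into the functions on a set to the
homomorphisms from a stabilizer. -/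
def evalStabilizer (x : X) :
    crossedHoms (permRep k H X) →ₗ[k] (Additive (MulAction.stabilizer H x) →+ k) where
  toFun f := AddMonoidHom.mk' (fun a => f a.toMul.1 x) fun a b => by
    have h := apply_mul_smul f a.toMul.1 b.toMul.1 x
    rwa [MulAction.mem_stabilizer_iff.1 a.toMul.2] at h
  map_add' _ _ := rfl
  map_smul' _ _ := rfl

theorem ker_evalStabilizer [MulAction.IsPretransitive H X] (x : X) :
    LinearMap.ker (evalStabilizer (k := k) (H := H) x) =
      LinearMap.range (coboundary (permRep k H X)) := by
  apply le_antisymm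
  · intro f hf
    have apply_stabilizer (a : H) (ha : a • x = x) : f a x = 0 :=
      DFunLike.congr_fun (LinearMap.mem_ker.1 hf) (Additive.ofMul ⟨a, ha⟩)
    choose s hs using MulAction.exists_smul_eq H x
    have apply_smul (g : H) : f g (g • x) = f (s (g • x)) (g • x) := by
      have h := apply_mul_smul f (s (g • x)) ((s (g • x))⁻¹ * g) x
      rwa [mul_inv_cancel_left, apply_stabilizer _ (by rw [mul_smul, inv_smul_eq_iff, hs]), hs,
        add_zero] at h
    refine ⟨fun y => -f (s y) y, ext fun g => funext fun y => ?_⟩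
    obtain ⟨y, rfl⟩ := MulAction.surjective g y
    have h := apply_mul_smul f g (s y) y
    have h' := apply_smul (g * s y)
    rw [mul_smul, hs] at h'
    simp only [coboundary_apply, Pi.sub_apply, permRep_apply, inv_smul_smul]
    linear_combination h - h'
  · rintro _ ⟨n, rfl⟩
    ext a
    exact sub_eq_zero.2 (congrArg n (inv_smul_eq_iff.2 a.2.symm))

theorem evalStabilizer_surjective [MulAction.IsPretransitive H X] (x : X) :
    Function.Surjective (evalStabilizer (k := k) (H := H) x) := by
  intro χ
  choose s hs using MulAction.exists_smul_eq H x
  let holonomy (g : H) (y : X) : MulAction.stabilizer H x :=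
    ⟨(s y)⁻¹ * g * s (g⁻¹ • y), by
      rw [MulAction.mem_stabilizer_iff, mul_smul, mul_smul, hs, smul_inv_smul, inv_smul_eq_iff, hs]⟩
  have holonomy_mul (g h : H) (y : X) :
      holonomy (g * h) y = holonomy g y * holonomy h (g⁻¹ • y) :=
    Subtype.ext <| by simp only [holonomy, Subgroup.coe_mul, mul_inv_rev, mul_smul]; group
  refine ⟨⟨fun g y => χ (.ofMul (holonomy g y)), fun g h => funext fun y => ?_⟩, ?_⟩
  · simp [holonomy_mul]
  · ext a
    let b : MulAction.stabilizer H x := ⟨s x, hs x⟩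
    have holonomy_stabilizer : holonomy a x = b⁻¹ * a * b :=
      Subtype.ext <| by simp only [holonomy, inv_smul_eq_iff.2 a.2.symm]; rfl
    change χ (.ofMul (holonomy a x)) = χ (.ofMul a)
    simp [holonomy_stabilizer]

end CommRing

variable [Field k] {H X}

theorem finrank_invariants_permRep [MulAction.IsPretransitive H X] [Nonempty X] :
    finrank k (permRep k H X).invariants = 1 := by
  have invariants_eq : (permRep k H X).invariants = Submodule.span k {1} := by
    ext n
    rw [Representation.mem_invariants, Submodule.mem_span_singleton]
    constructor
    · intro h
      obtain ⟨x⟩ := ‹Nonempty X›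
      refine ⟨n x, funext fun y => ?_⟩
      obtain ⟨g, rfl⟩ := MulAction.exists_smul_eq H y x
      simpa using (congrFun (h g) (g • y)).symm
    · rintro ⟨c, rfl⟩ g
      rfl
  rw [invariants_eq, finrank_span_singleton one_ne_zero]

theorem excess_permRep_of_isPretransitive [MulAction.IsPretransitive H X] [Finite X] [Group.FG H]
    (x : X) :
    excess (permRep k H X) = finrank k (Additive (MulAction.stabilizer H x) →+ k) - 1 := by
  have : Nonempty X := ⟨x⟩
  have h₁ := LinearMap.finrank_range_add_finrank_ker (evalStabilizer (k := k) (H := H) x)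
  have h₂ := LinearMap.finrank_range_add_finrank_ker (coboundary (permRep k H X))
  rw [LinearMap.range_eq_top.2 (evalStabilizer_surjective x), finrank_top,
    ker_evalStabilizer] at h₁
  rw [ker_coboundary, finrank_invariants_permRep] at h₂
  rw [excess, ← h₁, ← h₂]
  push_cast
  ring

theorem excess_permRep_eq_sum_orbits [Fintype (MulAction.orbitRel.Quotient H X)] [Finite X]
    [Group.FG H] : excess (permRep k H X) =
      ∑ ω : MulAction.orbitRel.Quotient H X, excess (permRep k H ω.orbit) := by
  have := fun ω : MulAction.orbitRel.Quotient H X => Subtype.finite (p := (· ∈ ω.orbit))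
  refine excess_eq_sum (fun ω : MulAction.orbitRel.Quotient H X => permRep k H ω.orbit)
    ((LinearEquiv.funCongrLeft k k (MulAction.selfEquivSigmaOrbits' H X).symm).trans
      (LinearEquiv.piCurry k fun _ _ => k)) fun g n ω => rfl

open scoped Pointwise in
theorem sum_bettiQuotient_stabilizer [MulAction.IsPretransitive H X] [Fintype X] (x : X) :
    ∑ y : X, bettiQuotient (MulAction.stabilizer H y) =
      firstBetti (MulAction.stabilizer H x) - 1 := by
  have bettiQuotient_eq (y : X) : bettiQuotient (MulAction.stabilizer H y) =
      bettiQuotient (MulAction.stabilizer H x) := by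
    obtain ⟨g, rfl⟩ := MulAction.exists_smul_eq H x y
    rw [MulAction.stabilizer_smul_eq_stabilizer_map_conj]
    exact bettiQuotient_conj_smul g _
  have hX : (Nat.card X : ℝ) ≠ 0 := by
    have : Nonempty X := ⟨x⟩
    exact_mod_cast Nat.card_pos.ne'
  rw [Finset.sum_congr rfl fun y _ => bettiQuotient_eq y, Finset.sum_const, Finset.card_univ,
    nsmul_eq_mul, bettiQuotient, MulAction.index_stabilizer_of_transitive,
    ← Nat.card_eq_fintype_card, mul_div_cancel₀ _ hX]

theorem excess_permRep [Fintype X] [Group.FG H] :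
    excess (permRep ℚ H X) = ∑ x : X, bettiQuotient (MulAction.stabilizer H x) := by
  classical
  have := Fintype.ofFinite (MulAction.orbitRel.Quotient H X)
  have := fun ω : MulAction.orbitRel.Quotient H X => Fintype.ofFinite ω.orbit
  rw [excess_permRep_eq_sum_orbits, ← (MulAction.selfEquivSigmaOrbits' H X).symm.sum_comp,
    Fintype.sum_sigma]
  refine Finset.sum_congr rfl fun ω _ => ?_
  obtain ⟨x⟩ := ω.nonempty_orbit.to_subtype
  rw [excess_permRep_of_isPretransitive ℚ x, finrank_addMonoidHom_rat,
    ← sum_bettiQuotient_stabilizer]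
  refine Finset.sum_congr rfl fun y _ => congrArg bettiQuotient ?_
  ext g
  exact Subtype.ext_iff

theorem excess_permRep_comp {A : Type*} [Group A] [Group.FG A] [Fintype X] (φ : A →* H) :
    excess ((permRep ℚ H X).comp φ) =
      ∑ x : X, bettiQuotient ((MulAction.stabilizer H x).comap φ) := by
  let _ : MulAction A X := MulAction.compHom X φ
  have h : (permRep ℚ H X).comp φ = permRep ℚ A X := by
    ext
    simp [MulAction.compHom_smul_def]
  rw [h, excess_permRep]
  rfl

end crossedHoms

end PermutationRepresentation

theorem exists_update_component {V P : Type*} [Group P] (Γ : SimpleGraph V) {a b : V}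
    (hab : ¬ Γ.Reachable a b) (s : V → P) (p : P) :
    ∃ s' : V → P, s' b = s' a * p ∧
      ∀ x y, Γ.Reachable x y → (s' x)⁻¹ * s' y = (s x)⁻¹ * s y := by
  classical
  refine ⟨fun v => if Γ.Reachable b v then s a * p * (s b)⁻¹ * s v else s v, ?_, fun x y hxy => ?_⟩
  · simp only [if_pos (SimpleGraph.Reachable.refl b), if_neg (mt SimpleGraph.Reachable.symm hab),
      inv_mul_cancel_right]
  · have h : Γ.Reachable b x ↔ Γ.Reachable b y :=
      ⟨fun h => h.trans hxy, fun h => h.trans hxy.symm⟩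
    by_cases hx : Γ.Reachable b x
    · simp only [if_pos hx, if_pos (h.1 hx)]
      group
    · simp only [if_neg hx, if_neg (mt h.2 hx)]

namespace GraphOfGroups

variable {V : Type u} {E : Type v} (𝒢 : GraphOfGroups.{u, v, w, x} V E) (T : Set E)

section FundamentalGroup

/-- The canonical homomorphism from a vertex group to the fundamental group. -/
def of (u : V) : 𝒢.vertexGroup u →* 𝒢.FundamentalGroup T :=
  (QuotientGroup.mk' _).comp (𝒢.preOf u)

/-- The stable letter of an edge in the fundamental group. -/
def stableLetter (e : E) : 𝒢.FundamentalGroup T :=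
  QuotientGroup.mk' _ (𝒢.preT e)

/-- The canonical homomorphism from an edge group to the fundamental group, through the group of
the initial vertex. -/
def ofEdge (e : E) : 𝒢.edgeGroup e →* 𝒢.FundamentalGroup T :=
  (𝒢.of T (𝒢.src e)).comp (𝒢.toSrc e)

theorem stableLetter_mul (e : E) (a : 𝒢.edgeGroup e) :
    𝒢.stableLetter T e * 𝒢.of T (𝒢.tgt e) (𝒢.toTgt e a) =
      𝒢.ofEdge T e a * 𝒢.stableLetter T e := by
  rw [← mul_inv_eq_iff_eq_mul, ← mul_inv_eq_one]
  exact (QuotientGroup.eq_one_iff _).2 (Subgroup.subset_normalClosure (Or.inl ⟨e, a, rfl⟩))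

variable {T} in
theorem stableLetter_eq_one {e : E} (he : e ∈ T) : 𝒢.stableLetter T e = 1 :=
  (QuotientGroup.eq_one_iff _).2 (Subgroup.subset_normalClosure (Or.inr ⟨e, he, rfl⟩))

theorem iSup_range_of_sup_closure_stableLetter :
    (⨆ u, (𝒢.of T u).range) ⊔ Subgroup.closure (Set.range (𝒢.stableLetter T)) = ⊤ := by
  have range_inl : ((QuotientGroup.mk' (Subgroup.normalClosure (𝒢.relators T))).comp
      Monoid.Coprod.inl).range = ⨆ u, (𝒢.of T u).range := by
    rw [← Monoid.CoprodI.range_eq_iSup]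
    congr 1
    ext
    simp [of, preOf]
  have range_inr : ((QuotientGroup.mk' (Subgroup.normalClosure (𝒢.relators T))).comp
      Monoid.Coprod.inr).range = Subgroup.closure (Set.range (𝒢.stableLetter T)) := by
    rw [← FreeGroup.range_lift_eq_closure]
    congr 1
    ext
    simp [stableLetter, preT]
  rw [← range_inl, ← range_inr, ← Monoid.Coprod.range_eq,
    MonoidHom.range_eq_top.2 (QuotientGroup.mk'_surjective _)]

theorem closure_iUnion_range_of_union_stableLetter :
    Subgroup.closure ((⋃ u, Set.range (𝒢.of T u)) ∪ Set.range (𝒢.stableLetter T)) = ⊤ := by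
  simp only [Subgroup.closure_union, Subgroup.closure_iUnion, ← MonoidHom.coe_range,
    Subgroup.closure_eq, iSup_range_of_sup_closure_stableLetter]

instance [Finite V] [Finite E] [∀ u, Group.FG (𝒢.vertexGroup u)] :
    Group.FG (𝒢.FundamentalGroup T) := by
  rw [Group.fg_def, ← iSup_range_of_sup_closure_stableLetter]
  exact (Subgroup.FG.iSup _ fun u => (Group.fg_iff_subgroup_fg _).1 inferInstance).sup
    ((Subgroup.fg_iff _).2 ⟨_, rfl, Set.finite_range _⟩)

variable {𝒢 T}
variable {P : Type*} [Group P]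

theorem hom_ext {Φ Ψ : 𝒢.FundamentalGroup T →* P} (h_of : ∀ u a, Φ (𝒢.of T u a) = Ψ (𝒢.of T u a))
    (h_stableLetter : ∀ e, Φ (𝒢.stableLetter T e) = Ψ (𝒢.stableLetter T e)) : Φ = Ψ := by
  refine MonoidHom.eq_of_eqOn_dense (𝒢.closure_iUnion_range_of_union_stableLetter T) ?_
  rintro _ (⟨_, ⟨u, rfl⟩, a, rfl⟩ | ⟨e, rfl⟩)
  exacts [h_of u a, h_stableLetter e]

/-- The universal property of the fundamental group. -/
def lift (φ : ∀ u, 𝒢.vertexGroup u →* P) (c : E → P)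
    (hc : ∀ e a, c e * φ (𝒢.tgt e) (𝒢.toTgt e a) = φ (𝒢.src e) (𝒢.toSrc e a) * c e)
    (hcT : ∀ e ∈ T, c e = 1) : 𝒢.FundamentalGroup T →* P :=
  QuotientGroup.lift _ (Monoid.Coprod.lift (Monoid.CoprodI.lift φ) (FreeGroup.lift c)) <| by
    refine Subgroup.normalClosure_le_normal ?_
    rintro r (⟨e, a, rfl⟩ | ⟨e, he, rfl⟩)
    · simp [preT, preOf, hc]
    · simp [preT, hcT e he]

variable (φ : ∀ u, 𝒢.vertexGroup u →* P) (c : E → P)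
  (hc : ∀ e a, c e * φ (𝒢.tgt e) (𝒢.toTgt e a) = φ (𝒢.src e) (𝒢.toSrc e a) * c e)
  (hcT : ∀ e ∈ T, c e = 1)

@[simp]
theorem lift_of (u : V) (a : 𝒢.vertexGroup u) : lift φ c hc hcT (𝒢.of T u a) = φ u a := by
  simp [lift, of, preOf]

@[simp]
theorem lift_stableLetter (e : E) : lift φ c hc hcT (𝒢.stableLetter T e) = c e := by
  simp [lift, stableLetter, preT]

end FundamentalGroup

section SpanningTree

namespace IsSpanningTree

variable {𝒢 T}

theorem adj (hT : 𝒢.IsSpanningTree T) {F : Set E} (hF : F ⊆ T) {e : E} (he : e ∈ F) :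
    (SimpleGraph.fromEdgeSet (𝒢.ends '' F)).Adj (𝒢.src e) (𝒢.tgt e) :=
  (SimpleGraph.fromEdgeSet_adj _).2 ⟨⟨e, he, rfl⟩, hT.not_loop e (hF he)⟩

theorem not_reachable (hT : 𝒢.IsSpanningTree T) {F : Set E} (hF : F ⊆ T) {e : E} (heT : e ∈ T)
    (heF : e ∉ F) :
    ¬ (SimpleGraph.fromEdgeSet (𝒢.ends '' F)).Reachable (𝒢.src e) (𝒢.tgt e) := by
  have bridge := SimpleGraph.isAcyclic_iff_forall_adj_isBridge.1 hT.isTree.isAcyclic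
    (hT.adj subset_rfl heT)
  rw [SimpleGraph.isBridge_iff, SimpleGraph.deleteEdges_fromEdgeSet] at bridge
  refine mt (SimpleGraph.Reachable.mono (SimpleGraph.fromEdgeSet_mono ?_)) bridge
  rintro _ ⟨f, hf, rfl⟩
  exact ⟨⟨f, hF hf, rfl⟩, fun h => heF (hT.injOn_ends (hF hf) heT h ▸ hf)⟩

theorem exists_potential [Finite E] (hT : 𝒢.IsSpanningTree T) {P : Type*} [Group P] (c : E → P) :
    ∃ s : V → P, ∀ e ∈ T, s (𝒢.tgt e) = s (𝒢.src e) * c e := by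
  refine Set.Finite.induction_on_subset
    (motive := fun F _ => ∃ s : V → P, ∀ e ∈ F, s (𝒢.tgt e) = s (𝒢.src e) * c e)
    T (Set.toFinite T) ⟨1, by simp⟩ ?_
  rintro e F he hF heF ⟨s, hs⟩
  obtain ⟨s', hs'e, hs'⟩ := exists_update_component _ (hT.not_reachable hF he heF) s (c e)
  refine ⟨s', Set.forall_mem_insert.2 ⟨hs'e, fun f hf => ?_⟩⟩
  rw [← inv_mul_eq_iff_eq_mul, hs' _ _ (hT.adj hF hf).reachable, hs f hf, inv_mul_cancel_left]

theorem ncard_add_one [Finite V] (hT : 𝒢.IsSpanningTree T) : T.ncard + 1 = Nat.card V := by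
  classical
  have := Fintype.ofFinite V
  rw [Nat.card_eq_fintype_card, ← hT.isTree.card_edgeFinset, ← hT.injOn_ends.ncard_image,
    ← Set.ncard_coe_finset, SimpleGraph.coe_edgeFinset, SimpleGraph.edgeSet_fromEdgeSet,
    sdiff_eq_left.2 (Set.disjoint_left.2 ?_)]
  rintro _ ⟨e, he, rfl⟩
  exact hT.not_loop e he

end IsSpanningTree

end SpanningTree

section MayerVietoris

open crossedHoms

section Sequence

variable {k M : Type*} [CommRing k] [AddCommGroup M] [Module k M]
  (ρ : Representation k (𝒢.FundamentalGroup T) M)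

/-- The restriction of a crossed homomorphism of the fundamental group to the vertex groups,
together with its values on the stable letters. -/
def restrict : crossedHoms ρ →ₗ[k] (∀ u, crossedHoms (ρ.comp (𝒢.of T u))) × (E → M) where
  toFun f := (fun u => comap (𝒢.of T u) f, fun e => f (𝒢.stableLetter T e))
  map_add' _ _ := rfl
  map_smul' _ _ := rfl

theorem restrict_injective : Function.Injective (𝒢.restrict T ρ) := by
  intro f f' h
  have eqOn_generators :
      Set.EqOn f f' ((⋃ u, Set.range (𝒢.of T u)) ∪ Set.range (𝒢.stableLetter T)) := by
    rintro _ (⟨_, ⟨u, rfl⟩, a, rfl⟩ | ⟨e, rfl⟩)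
    · exact DFunLike.congr_fun (congrFun (congrArg Prod.fst h) u) a
    · exact congrFun (congrArg Prod.snd h) e
  refine ext fun g => eqOn_closure eqOn_generators ?_
  rw [closure_iUnion_range_of_union_stableLetter]
  exact Subgroup.mem_top g

theorem rep_stableLetter_mul (e : E) (a : 𝒢.edgeGroup e) (m : M) :
    ρ (𝒢.stableLetter T e) (ρ (𝒢.of T (𝒢.tgt e) (𝒢.toTgt e a)) m) =
      ρ (𝒢.ofEdge T e a) (ρ (𝒢.stableLetter T e) m) := by
  simp only [← Module.End.mul_apply, ← map_mul, stableLetter_mul]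

/-- The obstruction for crossed homomorphisms of the vertex groups and values on the stable letters
to respect the relations `t_e * a_tgt = a_src * t_e` of an edge. -/
def edgeObstruction (e : E) : (∀ u, crossedHoms (ρ.comp (𝒢.of T u))) × (E → M) →ₗ[k]
    crossedHoms (ρ.comp (𝒢.ofEdge T e)) :=
  let srcTerm : (∀ u, crossedHoms (ρ.comp (𝒢.of T u))) →ₗ[k] crossedHoms (ρ.comp (𝒢.ofEdge T e)) :=
    comap (𝒢.toSrc e) ∘ₗ LinearMap.proj (𝒢.src e)
  let tgtTerm : (∀ u, crossedHoms (ρ.comp (𝒢.of T u))) →ₗ[k] crossedHoms (ρ.comp (𝒢.ofEdge T e)) :=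
    map (ρ (𝒢.stableLetter T e)) (𝒢.rep_stableLetter_mul T ρ e) ∘ₗ comap (𝒢.toTgt e) ∘ₗ
      LinearMap.proj (𝒢.tgt e)
  (srcTerm - tgtTerm).coprod (coboundary (ρ.comp (𝒢.ofEdge T e)) ∘ₗ LinearMap.proj e)

theorem edgeObstruction_apply (p : (∀ u, crossedHoms (ρ.comp (𝒢.of T u))) × (E → M)) (e : E)
    (a : 𝒢.edgeGroup e) : 𝒢.edgeObstruction T ρ e p a =
      p.1 (𝒢.src e) (𝒢.toSrc e a) - ρ (𝒢.stableLetter T e) (p.1 (𝒢.tgt e) (𝒢.toTgt e a)) +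
        (ρ (𝒢.ofEdge T e a) (p.2 e) - p.2 e) :=
  rfl

theorem edgeObstruction_apply_eq_zero_iff {p : (∀ u, crossedHoms (ρ.comp (𝒢.of T u))) × (E → M)}
    {e : E} {a : 𝒢.edgeGroup e} : 𝒢.edgeObstruction T ρ e p a = 0 ↔
      p.2 e + ρ (𝒢.stableLetter T e) (p.1 (𝒢.tgt e) (𝒢.toTgt e a)) =
        p.1 (𝒢.src e) (𝒢.toSrc e a) + ρ (𝒢.ofEdge T e a) (p.2 e) := by
  rw [edgeObstruction_apply, sub_add_sub_comm, sub_eq_zero, add_comm (p.2 e), eq_comm]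

theorem edgeObstruction_coboundary (w : V → M) (c : E → M) (e : E) :
    𝒢.edgeObstruction T ρ e (fun u => coboundary (ρ.comp (𝒢.of T u)) (w u), c) =
      coboundary (ρ.comp (𝒢.ofEdge T e))
        (w (𝒢.src e) + c e - ρ (𝒢.stableLetter T e) (w (𝒢.tgt e))) := by
  ext a
  rw [edgeObstruction_apply, coboundary_apply, coboundary_apply, coboundary_apply]
  simp only [MonoidHom.comp_apply, map_sub, map_add, rep_stableLetter_mul, ofEdge]
  abel

/-- The joint obstruction of all the relations of the fundamental group. -/
def obstruction : (∀ u, crossedHoms (ρ.comp (𝒢.of T u))) × (E → M) →ₗ[k]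
    (∀ e, crossedHoms (ρ.comp (𝒢.ofEdge T e))) × (T → M) :=
  (LinearMap.pi (𝒢.edgeObstruction T ρ)).prod
    (LinearMap.funLeft k M Subtype.val ∘ₗ LinearMap.snd k _ _)

theorem mem_ker_obstruction {p : (∀ u, crossedHoms (ρ.comp (𝒢.of T u))) × (E → M)} :
    p ∈ LinearMap.ker (𝒢.obstruction T ρ) ↔
      (∀ e, 𝒢.edgeObstruction T ρ e p = 0) ∧ ∀ e ∈ T, p.2 e = 0 := by
  simp [obstruction, LinearMap.mem_ker, funext_iff, LinearMap.funLeft]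

theorem range_restrict_le_ker_obstruction :
    LinearMap.range (𝒢.restrict T ρ) ≤ LinearMap.ker (𝒢.obstruction T ρ) := by
  rintro _ ⟨f, rfl⟩
  refine (𝒢.mem_ker_obstruction T ρ).2 ⟨fun e => ext fun a => ?_, fun e he => ?_⟩
  · have h := congrArg f (𝒢.stableLetter_mul T e a)
    rw [apply_mul, apply_mul] at h
    exact (𝒢.edgeObstruction_apply_eq_zero_iff T ρ).2 h
  · change f (𝒢.stableLetter T e) = 0
    rw [𝒢.stableLetter_eq_one he, apply_one]

theorem ker_obstruction_le_range_restrict :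
    LinearMap.ker (𝒢.obstruction T ρ) ≤ LinearMap.range (𝒢.restrict T ρ) := by
  intro p hp
  obtain ⟨edgeObstruction_eq_zero, apply_eq_zero⟩ := (𝒢.mem_ker_obstruction T ρ).1 hp
  let t (e : E) : Multiplicative M ⋊[toMulAut ρ] 𝒢.FundamentalGroup T :=
    ⟨.ofAdd (p.2 e), 𝒢.stableLetter T e⟩
  obtain ⟨Φ, Φ_of, Φ_stableLetter⟩ :
      ∃ Φ : 𝒢.FundamentalGroup T →* Multiplicative M ⋊[toMulAut ρ] 𝒢.FundamentalGroup T,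
        (∀ u a, Φ (𝒢.of T u a) = toSemidirect (p.1 u) a) ∧ ∀ e, Φ (𝒢.stableLetter T e) = t e := by
    refine ⟨lift (fun u => toSemidirect (p.1 u)) t (fun e a => ?_) fun e he => ?_,
      lift_of _ _ _ _, lift_stableLetter _ _ _ _⟩
    · exact SemidirectProduct.ext (congrArg Multiplicative.ofAdd
        ((𝒢.edgeObstruction_apply_eq_zero_iff T ρ).1
          (DFunLike.congr_fun (edgeObstruction_eq_zero e) a))) (𝒢.stableLetter_mul T e a)
    · exact SemidirectProduct.ext (congrArg Multiplicative.ofAdd (apply_eq_zero e he))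
        (𝒢.stableLetter_eq_one he)
  have right_Φ : SemidirectProduct.rightHom.comp Φ = MonoidHom.id _ :=
    hom_ext (fun u a => congrArg SemidirectProduct.right (Φ_of u a))
      fun e => congrArg SemidirectProduct.right (Φ_stableLetter e)
  refine ⟨ofSemidirect Φ (DFunLike.congr_fun right_Φ), Prod.ext ?_ ?_⟩
  · exact funext fun u => ext fun a => congrArg (fun g => g.left.toAdd) (Φ_of u a)
  · exact funext fun e => congrArg (fun g => g.left.toAdd) (Φ_stableLetter e)

end Sequence

variable {𝒢 T}

namespace IsSpanningTree

variable {k M : Type*} [Field k] [AddCommGroup M] [Module k M]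
  (ρ : Representation k (𝒢.FundamentalGroup T) M)

theorem obstruction_surjective [Finite E] (hT : 𝒢.IsSpanningTree T)
    [∀ e, NeZero (Nat.card (𝒢.edgeGroup e) : k)] : Function.Surjective (𝒢.obstruction T ρ) := by
  rintro ⟨β, γ⟩
  choose n hn using fun e => coboundary_surjective _ (β e)
  obtain ⟨γ, rfl⟩ := Subtype.val_injective.surjective_comp_right γ
  obtain ⟨w, hw⟩ := hT.exists_potential (P := Multiplicative M) fun e => .ofAdd (γ e - n e)
  let w' (u : V) : M := (w u).toAdd
  refine ⟨(fun u => coboundary _ (w' u),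
    fun e => n e - w' (𝒢.src e) + ρ (𝒢.stableLetter T e) (w' (𝒢.tgt e))),
    Prod.ext (funext fun e => ?_) (funext fun e => ?_)⟩
  · refine (𝒢.edgeObstruction_coboundary T ρ w' _ e).trans ?_
    change _ = β e
    rw [← hn]
    congr 1
    abel
  · change n e - w' (𝒢.src e) + ρ (𝒢.stableLetter T e) (w' (𝒢.tgt e)) = γ e
    have hw'e : w' (𝒢.tgt e) = w' (𝒢.src e) + (γ e - n e) :=
      congrArg Multiplicative.toAdd (hw e e.2)
    rw [𝒢.stableLetter_eq_one e.2, map_one, Module.End.one_apply, hw'e]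
    abel

theorem excess_eq [Fintype V] [Fintype E] [Module.Finite k M] (hT : 𝒢.IsSpanningTree T)
    [∀ u, Group.FG (𝒢.vertexGroup u)] [∀ e, NeZero (Nat.card (𝒢.edgeGroup e) : k)] :
    excess ρ = ∑ u, excess (ρ.comp (𝒢.of T u)) - ∑ e, excess (ρ.comp (𝒢.ofEdge T e)) := by
  classical
  have (e : E) : Finite (𝒢.edgeGroup e) := Nat.finite_of_card_ne_zero fun h =>
    NeZero.ne (Nat.card (𝒢.edgeGroup e) : k) (by rw [h, Nat.cast_zero])
  have finrank_eq := LinearMap.finrank_range_add_finrank_ker (𝒢.obstruction T ρ)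
  rw [LinearMap.range_eq_top.2 (hT.obstruction_surjective ρ), finrank_top,
    (𝒢.ker_obstruction_le_range_restrict T ρ).antisymm (𝒢.range_restrict_le_ker_obstruction T ρ),
    LinearMap.finrank_range_of_inj (𝒢.restrict_injective T ρ), finrank_prod, finrank_prod,
    finrank_pi_fintype, finrank_pi_fintype k (M := fun _ : T => M),
    finrank_pi_fintype k (M := fun u => crossedHoms (ρ.comp (𝒢.of T u))),
    finrank_pi_fintype k (M := fun _ : E => M)] at finrank_eq
  have card_V : Fintype.card V = Fintype.card T + 1 := by
    rw [← Nat.card_eq_fintype_card, ← hT.ncard_add_one, ← Nat.card_coe_set_eq,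
      Nat.card_eq_fintype_card]
  have finrank_eq' := congrArg (Nat.cast : ℕ → ℝ) finrank_eq
  simp only [excess, Finset.sum_sub_distrib, Finset.sum_const, Finset.card_univ, nsmul_eq_mul,
    smul_eq_mul, card_V, Nat.cast_add, Nat.cast_sum, Nat.cast_mul, Nat.cast_one] at finrank_eq' ⊢
  linarith

end IsSpanningTree

end MayerVietoris

end GraphOfGroups

section FiniteActions

open MulAction Pointwise

theorem comap_stabilizer_smul {G H X : Type*} [Group G] [Group H] [MulAction H X] (φ : G →* H)
    (g : G) (x : X) :
    (stabilizer H (φ g • x)).comap φ = MulAut.conj g • (stabilizer H x).comap φ := by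
  ext h
  simp [Subgroup.mem_pointwise_smul_iff_inv_smul_mem, MulAut.smul_def, mul_smul,
    inv_smul_eq_iff]

theorem stabilizer_mk_eq_conj_smul {G : Type*} [Group G] (K : Subgroup G) (g : G) :
    stabilizer G (g : G ⧸ K) = MulAut.conj g • K := by
  simpa [stabilizer_quotient] using comap_stabilizer_smul (MonoidHom.id G) g ((1 : G) : G ⧸ K)

theorem comap_mulSingle_stabilizer_pi {ι : Type*} [DecidableEq ι] {G X : ι → Type*}
    [∀ i, Group (G i)] [∀ i, MulAction (G i) (X i)] (i : ι) (x : ∀ i, X i) :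
    (stabilizer (∀ i, G i) x).comap (MonoidHom.mulSingle G i) = stabilizer (G i) (x i) := by
  ext a
  refine ⟨fun h => by simpa using congrFun h i, fun h => funext fun j => ?_⟩
  obtain rfl | hji := eq_or_ne j i
  · simpa using h
  · simp [hji]

variable {A X Y : Type*} [Group A]

theorem exists_equiv_prod_of_free [MulAction A X] (hX : ∀ x : X, stabilizer A x = ⊥) :
    ∃ c : orbitRel.Quotient A X × A ≃ X, ∀ ω a b, c (ω, a * b) = a • c (ω, b) := by
  refine ⟨.ofBijective (fun p => p.2 • p.1.out) ⟨?_, fun x => ?_⟩, fun ω a b => mul_smul a b _⟩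
  · rintro ⟨ω, a⟩ ⟨ω', a'⟩ (h : a • ω.out = a' • ω'.out)
    have smul_out : (a'⁻¹ * a) • ω.out = ω'.out := by rw [mul_smul, h, inv_smul_smul]
    obtain rfl : ω = ω' := by
      rw [← ω.out_eq, ← ω'.out_eq, eq_comm]
      exact Quotient.sound ⟨_, smul_out⟩
    have mem_stabilizer : a'⁻¹ * a ∈ stabilizer A ω.out := smul_out
    rw [hX, Subgroup.mem_bot, inv_mul_eq_one] at mem_stabilizer
    rw [mem_stabilizer]
  · obtain ⟨a, ha⟩ := Quotient.mk_out (s := orbitRel A X) x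
    exact ⟨(Quotient.mk _ x, a⁻¹), inv_smul_eq_iff.2 ha.symm⟩

theorem exists_equivariant_equiv_of_free [MulAction A X] [MulAction A Y] [Finite A] [Finite X]
    [Finite Y] (hX : ∀ x : X, stabilizer A x = ⊥) (hY : ∀ y : Y, stabilizer A y = ⊥)
    (hcard : Nat.card X = Nat.card Y) : ∃ c : X ≃ Y, ∀ (a : A) x, c (a • x) = a • c x := by
  obtain ⟨cX, hcX⟩ := exists_equiv_prod_of_free hX
  obtain ⟨cY, hcY⟩ := exists_equiv_prod_of_free hY
  have card_quotient : Nat.card (orbitRel.Quotient A X) = Nat.card (orbitRel.Quotient A Y) := by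
    rw [← Nat.card_congr cX, ← Nat.card_congr cY, Nat.card_prod, Nat.card_prod] at hcard
    exact Nat.eq_of_mul_eq_mul_right Nat.card_pos hcard
  obtain ⟨e⟩ := Finite.card_eq.1 card_quotient
  refine ⟨cX.symm.trans ((e.prodCongr (.refl A)).trans cY), fun a x => ?_⟩
  obtain ⟨⟨ω, b⟩, rfl⟩ := cX.surjective x
  simp [← hcX, hcY]

theorem exists_conj_of_free [Finite A] [Finite X] (α β : A →* Equiv.Perm X)
    (hα : ∀ x : X, (stabilizer (Equiv.Perm X) x).comap α = ⊥)
    (hβ : ∀ x : X, (stabilizer (Equiv.Perm X) x).comap β = ⊥) :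
    ∃ c : Equiv.Perm X, ∀ a, c * α a = β a * c := by
  obtain ⟨c, hc⟩ := @exists_equivariant_equiv_of_free A X X _ (compHom X α) (compHom X β) _ _ _
    hα hβ rfl
  exact ⟨c, fun a => Equiv.ext (hc a)⟩

end FiniteActions

section SeparatingSubgroups

variable {G : Type*} [Group G]

open Pointwise in
theorem conj_smul_le {K N : Subgroup G} [N.Normal] (hKN : K ≤ N) (g : G) :
    MulAut.conj g • K ≤ N :=
  (Subgroup.pointwise_smul_le_pointwise_smul_iff.2 hKN).trans_eq
    (Subgroup.Normal.conj_smul_eq_self g N)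

theorem finiteIndex_comap {H : Type*} [Group H] (φ : H →* G) (K : Subgroup G) [K.FiniteIndex] :
    (K.comap φ).FiniteIndex :=
  ⟨by
    rw [Subgroup.index_comap]
    exact mt Subgroup.index_eq_zero_of_relIndex_eq_zero Subgroup.FiniteIndex.index_ne_zero⟩

theorem exists_normal_mem_imp_eq_one (hG : Group.ResiduallyFinite G ∨ IsVirtuallyTorsionFree G)
    {g : G} (hg : IsOfFinOrder g) :
    ∃ N : Subgroup G, (N.Normal ∧ N.FiniteIndex) ∧ (g ∈ N → g = 1) := by
  obtain rfl | hg1 := eq_or_ne g 1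
  · exact ⟨⊤, ⟨inferInstance, inferInstance⟩, fun _ => rfl⟩
  rcases hG with hG | ⟨H, hH, htf⟩
  · obtain ⟨N, hN⟩ := Group.exists_finiteIndexNormalSubgroup_notMem g hg1
    exact ⟨N.toSubgroup, ⟨inferInstance, inferInstance⟩, fun h => absurd h hN⟩
  · exact ⟨H.normalCore, ⟨inferInstance, inferInstance⟩, fun h => htf g (H.normalCore_le h) hg⟩

theorem exists_normal_comap_eq_bot (hG : Group.ResiduallyFinite G ∨ IsVirtuallyTorsionFree G)
    {A : Type*} [Group A] [Finite A] {φ : A →* G} (hφ : Function.Injective φ) :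
    ∃ N : Subgroup G, (N.Normal ∧ N.FiniteIndex) ∧ N.comap φ = ⊥ := by
  choose N hN hφN using fun a =>
    exists_normal_mem_imp_eq_one hG (φ.isOfFinOrder (isOfFinOrder_of_finite a))
  refine ⟨⨅ a, N a, ⟨Subgroup.normal_iInf_normal fun a => (hN a).1,
    Subgroup.finiteIndex_iInf fun a => (hN a).2⟩, (Subgroup.eq_bot_iff_forall _).2 fun a ha => ?_⟩
  exact (map_eq_one_iff φ hφ).1 (hφN a (Subgroup.mem_iInf.1 ha a))

end SeparatingSubgroups

section BettiVolume

variable {G : Type*} [Group G]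

theorem exists_forall_bettiRatio_le [Group.FG G] {ε : ℝ} (hε : 0 < ε) :
    ∃ H : FinIndexSubgroup G, ∀ K ≤ H, bettiRatio G K ≤ bettiVolume G + ε := by
  have bounded : Filter.IsBoundedUnder (· ≤ ·) Filter.atBot (bettiRatio G) :=
    Filter.isBoundedUnder_of ⟨Group.rank G + 1, fun H => (abs_le.1 (abs_bettiRatio_le G H)).2⟩
  obtain ⟨H, hH⟩ := Filter.eventually_atBot.1
    (Filter.eventually_lt_of_limsup_lt (lt_add_of_pos_right (bettiVolume G) hε) bounded)
  exact ⟨H, fun K hK => (hH K hK).le⟩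

theorem exists_le_bettiRatio [Group.FG G] {ε : ℝ} (hε : 0 < ε) (H : FinIndexSubgroup G) :
    ∃ K ≤ H, bettiVolume G - ε ≤ bettiRatio G K := by
  have bounded : Filter.IsBoundedUnder (· ≥ ·) Filter.atBot (bettiRatio G) :=
    Filter.isBoundedUnder_of ⟨-(Group.rank G + 1 : ℝ), fun H =>
      (abs_le.1 (abs_bettiRatio_le G H)).1⟩
  obtain ⟨K, hK, h⟩ := Filter.frequently_atBot.1 (Filter.frequently_lt_of_lt_limsup
    bounded.isCoboundedUnder_le (sub_lt_self (bettiVolume G) hε)) H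
  exact ⟨K, hK, h.le⟩

theorem bettiVolume_eq_of_forall (L : ℝ)
    (upper : ∀ ε > 0, ∃ H : FinIndexSubgroup G, ∀ K ≤ H, bettiRatio G K ≤ L + ε)
    (lower : ∀ ε > 0, ∀ H : FinIndexSubgroup G, ∃ K ≤ H, L - ε ≤ bettiRatio G K) :
    bettiVolume G = L := by
  have frequently_ge (ε : ℝ) (hε : 0 < ε) : ∃ᶠ K in Filter.atBot, L - ε ≤ bettiRatio G K :=
    Filter.frequently_atBot.2 (lower ε hε)
  have eventually_le (ε : ℝ) (hε : 0 < ε) : ∀ᶠ K in Filter.atBot, bettiRatio G K ≤ L + ε :=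
    Filter.eventually_atBot.2 (upper ε hε)
  refine le_antisymm (le_of_forall_pos_le_add fun ε hε => ?_)
    (le_of_forall_pos_le_add fun ε hε => sub_le_iff_le_add.1 ?_)
  · exact Filter.limsup_le_of_le (.of_frequently_ge (frequently_ge 1 one_pos))
      (eventually_le ε hε)
  · exact Filter.le_limsup_of_frequently_le (frequently_ge ε hε)
      ⟨L + 1, Filter.eventually_map.2 (eventually_le 1 one_pos)⟩

end BettiVolume

namespace GraphOfGroups

open crossedHoms MulAction Pointwise

variable {V : Type u} {E : Type v} {𝒢 : GraphOfGroups.{u, v, w, x} V E} {T : Set E}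

section AverageFormula

variable [Fintype V] [Fintype E] [∀ u, Group.FG (𝒢.vertexGroup u)] [∀ e, Finite (𝒢.edgeGroup e)]

namespace IsSpanningTree

theorem sum_bettiQuotient_stabilizer_eq (hT : 𝒢.IsSpanningTree T) {X : Type*} [Fintype X]
    [MulAction (𝒢.FundamentalGroup T) X]
    (hX : ∀ e (y : X), (stabilizer (𝒢.FundamentalGroup T) y).comap (𝒢.ofEdge T e) = ⊥) :
    ∑ y : X, bettiQuotient (stabilizer (𝒢.FundamentalGroup T) y) =
      ∑ y : X, (∑ u, bettiQuotient ((stabilizer (𝒢.FundamentalGroup T) y).comap (𝒢.of T u)) +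
        ∑ e, 1 / (Nat.card (𝒢.edgeGroup e) : ℝ)) := by
  have (e : E) : NeZero (Nat.card (𝒢.edgeGroup e) : ℚ) := ⟨Nat.cast_ne_zero.2 Nat.card_pos.ne'⟩
  rw [← excess_permRep, hT.excess_eq]
  simp only [excess_permRep_comp, hX, bettiQuotient_bot, Finset.sum_neg_distrib,
    sub_neg_eq_add, Finset.sum_add_distrib]
  rw [Finset.sum_comm, Finset.sum_comm (s := (Finset.univ : Finset E))]

variable {K : Subgroup (𝒢.FundamentalGroup T)}

theorem sum_bettiQuotient_eq (hT : 𝒢.IsSpanningTree T) [Fintype (𝒢.FundamentalGroup T ⧸ K)]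
    (hK : ∀ e (g : 𝒢.FundamentalGroup T), (MulAut.conj g • K).comap (𝒢.ofEdge T e) = ⊥) :
    ∑ _y : 𝒢.FundamentalGroup T ⧸ K, bettiQuotient K = ∑ y : 𝒢.FundamentalGroup T ⧸ K,
      (∑ u, bettiQuotient ((MulAut.conj y.out • K).comap (𝒢.of T u)) +
        ∑ e, 1 / (Nat.card (𝒢.edgeGroup e) : ℝ)) := by
  have stabilizer_eq (y : 𝒢.FundamentalGroup T ⧸ K) :
      stabilizer (𝒢.FundamentalGroup T) y = MulAut.conj y.out • K := by
    rw [← stabilizer_mk_eq_conj_smul, QuotientGroup.out_eq']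
  simpa only [stabilizer_eq, bettiQuotient_conj_smul] using
    hT.sum_bettiQuotient_stabilizer_eq (X := 𝒢.FundamentalGroup T ⧸ K) fun e y => by
      rw [stabilizer_eq, hK]

theorem exists_bettiQuotient_le [K.FiniteIndex] (hT : 𝒢.IsSpanningTree T)
    (hK : ∀ e (g : 𝒢.FundamentalGroup T), (MulAut.conj g • K).comap (𝒢.ofEdge T e) = ⊥) :
    ∃ g : 𝒢.FundamentalGroup T, bettiQuotient K ≤
      ∑ u, bettiQuotient ((MulAut.conj g • K).comap (𝒢.of T u)) +
        ∑ e, 1 / (Nat.card (𝒢.edgeGroup e) : ℝ) := by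
  have := Fintype.ofFinite (𝒢.FundamentalGroup T ⧸ K)
  obtain ⟨y, -, hy⟩ := Finset.exists_le_of_sum_le Finset.univ_nonempty
    (hT.sum_bettiQuotient_eq hK).le
  exact ⟨y.out, hy⟩

theorem exists_le_bettiQuotient [K.FiniteIndex] (hT : 𝒢.IsSpanningTree T)
    (hK : ∀ e (g : 𝒢.FundamentalGroup T), (MulAut.conj g • K).comap (𝒢.ofEdge T e) = ⊥) :
    ∃ g : 𝒢.FundamentalGroup T,
      ∑ u, bettiQuotient ((MulAut.conj g • K).comap (𝒢.of T u)) +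
        ∑ e, 1 / (Nat.card (𝒢.edgeGroup e) : ℝ) ≤ bettiQuotient K := by
  have := Fintype.ofFinite (𝒢.FundamentalGroup T ⧸ K)
  obtain ⟨y, -, hy⟩ := Finset.exists_le_of_sum_le Finset.univ_nonempty
    (hT.sum_bettiQuotient_eq hK).ge
  exact ⟨y.out, hy⟩

end IsSpanningTree

end AverageFormula

section Gluing

theorem IsSpanningTree.exists_hom_conj [Finite E] [∀ e, Finite (𝒢.edgeGroup e)]
    (hT : 𝒢.IsSpanningTree T) {X : Type*} [Finite X] (σ : ∀ u, 𝒢.vertexGroup u →* Equiv.Perm X)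
    (hsrc : ∀ e (y : X), ((stabilizer (Equiv.Perm X) y).comap (σ (𝒢.src e))).comap
      (𝒢.toSrc e) = ⊥)
    (htgt : ∀ e (y : X), ((stabilizer (Equiv.Perm X) y).comap (σ (𝒢.tgt e))).comap
      (𝒢.toTgt e) = ⊥) :
    ∃ (ρ : 𝒢.FundamentalGroup T →* Equiv.Perm X) (s : V → Equiv.Perm X),
      ∀ u a, ρ (𝒢.of T u a) = s u * σ u a * (s u)⁻¹ := by
  choose c hc using fun e => exists_conj_of_free ((σ (𝒢.tgt e)).comp (𝒢.toTgt e))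
    ((σ (𝒢.src e)).comp (𝒢.toSrc e)) (htgt e) (hsrc e)
  obtain ⟨s, hs⟩ := hT.exists_potential c
  refine ⟨lift (fun u => (MulAut.conj (s u)).toMonoidHom.comp (σ u))
    (fun e => s (𝒢.src e) * c e * (s (𝒢.tgt e))⁻¹) (fun e a => ?_) fun e he => ?_, s,
    fun u a => lift_of ..⟩
  · calc s (𝒢.src e) * c e * (s (𝒢.tgt e))⁻¹ *
          (s (𝒢.tgt e) * σ (𝒢.tgt e) (𝒢.toTgt e a) * (s (𝒢.tgt e))⁻¹)
        = s (𝒢.src e) * (c e * σ (𝒢.tgt e) (𝒢.toTgt e a)) * (s (𝒢.tgt e))⁻¹ := by group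
      _ = s (𝒢.src e) * (σ (𝒢.src e) (𝒢.toSrc e a) * c e) * (s (𝒢.tgt e))⁻¹ :=
        congrArg (s (𝒢.src e) * · * (s (𝒢.tgt e))⁻¹) (hc e a)
      _ = s (𝒢.src e) * σ (𝒢.src e) (𝒢.toSrc e a) * (s (𝒢.src e))⁻¹ *
          (s (𝒢.src e) * c e * (s (𝒢.tgt e))⁻¹) := by group
  · rw [hs e he, mul_inv_cancel]

theorem IsSpanningTree.exists_comap_conj_eq [Finite V] [Finite E] [∀ e, Finite (𝒢.edgeGroup e)]
    (hT : 𝒢.IsSpanningTree T) (K : ∀ u, Subgroup (𝒢.vertexGroup u)) [∀ u, (K u).FiniteIndex]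
    (hsrc : ∀ e (b : 𝒢.vertexGroup (𝒢.src e)),
      (MulAut.conj b • K (𝒢.src e)).comap (𝒢.toSrc e) = ⊥)
    (htgt : ∀ e (b : 𝒢.vertexGroup (𝒢.tgt e)),
      (MulAut.conj b • K (𝒢.tgt e)).comap (𝒢.toTgt e) = ⊥) :
    ∃ L : Subgroup (𝒢.FundamentalGroup T), L.FiniteIndex ∧
      ∀ u (g : 𝒢.FundamentalGroup T), ∃ b : 𝒢.vertexGroup u,
        (MulAut.conj g • L).comap (𝒢.of T u) = MulAut.conj b • K u := by
  classical
  let X : Type _ := ∀ u, 𝒢.vertexGroup u ⧸ K u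
  let σ (u : V) : 𝒢.vertexGroup u →* Equiv.Perm X :=
    (toPermHom (∀ u, 𝒢.vertexGroup u) X).comp (MonoidHom.mulSingle _ u)
  have comap_stabilizer (u : V) (y : X) :
      ∃ b : 𝒢.vertexGroup u, (stabilizer (Equiv.Perm X) y).comap (σ u) =
        MulAut.conj b • K u := by
    obtain ⟨b, hb⟩ := QuotientGroup.mk_surjective (y u)
    exact ⟨b, (comap_mulSingle_stabilizer_pi u y).trans (hb ▸ stabilizer_mk_eq_conj_smul _ b)⟩
  obtain ⟨ρ, s, hρ⟩ := hT.exists_hom_conj σ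
    (fun e y => by obtain ⟨b, hb⟩ := comap_stabilizer (𝒢.src e) y; rw [hb, hsrc])
    (fun e y => by obtain ⟨b, hb⟩ := comap_stabilizer (𝒢.tgt e) y; rw [hb, htgt])
  let y : X := fun u => (1 : 𝒢.vertexGroup u)
  refine ⟨(stabilizer (Equiv.Perm X) y).comap ρ, finiteIndex_comap _ _, fun u g => ?_⟩
  obtain ⟨b, hb⟩ := comap_stabilizer u ((s u)⁻¹ • ρ g • y)
  refine ⟨b, .trans ?_ hb⟩
  rw [← comap_stabilizer_smul]
  ext a
  simp [hρ, Equiv.eq_symm_apply]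

end Gluing

section Separation

theorem comap_toTgt_eq_bot {M : Subgroup (𝒢.FundamentalGroup T)} [M.Normal] {e : E}
    (hM : M.comap (𝒢.ofEdge T e) = ⊥) :
    (M.comap (𝒢.of T (𝒢.tgt e))).comap (𝒢.toTgt e) = ⊥ := by
  rw [← hM]
  ext a
  have conj_eq : 𝒢.stableLetter T e * 𝒢.of T (𝒢.tgt e) (𝒢.toTgt e a) * (𝒢.stableLetter T e)⁻¹ =
      𝒢.ofEdge T e a := by rw [stableLetter_mul, mul_inv_cancel_right]
  simp only [Subgroup.mem_comap, ← conj_eq]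
  rw [Subgroup.Normal.mem_comm_iff ‹_›, inv_mul_cancel_left]

variable [Finite E] [∀ e, Finite (𝒢.edgeGroup e)]

variable (𝒢) in
theorem exists_normal_comap_toSrc_toTgt_eq_bot
    (hres : ∀ u, Group.ResiduallyFinite (𝒢.vertexGroup u) ∨
      IsVirtuallyTorsionFree (𝒢.vertexGroup u)) :
    ∃ N : ∀ u, Subgroup (𝒢.vertexGroup u), (∀ u, (N u).Normal ∧ (N u).FiniteIndex) ∧
      ∀ e, (N (𝒢.src e)).comap (𝒢.toSrc e) = ⊥ ∧ (N (𝒢.tgt e)).comap (𝒢.toTgt e) = ⊥ := by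
  classical
  have exists_normal_of_hom {u : V} {A : Type x} [Group A] [Finite A] {φ : A →* 𝒢.vertexGroup u}
      (hφ : Function.Injective φ) : ∃ N : ∀ u, Subgroup (𝒢.vertexGroup u),
        (∀ u, (N u).Normal ∧ (N u).FiniteIndex) ∧ (N u).comap φ = ⊥ := by
    obtain ⟨N, hN, hφN⟩ := exists_normal_comap_eq_bot (hres u) hφ
    refine ⟨Function.update ⊤ u N, (Function.forall_update_iff _
      (p := fun _ S => Subgroup.Normal S ∧ Subgroup.FiniteIndex S)).2 ⟨hN, fun _ _ =>
        ⟨Subgroup.normal_top, (inferInstance : (⊤ : Subgroup (𝒢.vertexGroup _)).FiniteIndex)⟩⟩,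
      by simpa⟩
  choose M hM hM_src using fun e => exists_normal_of_hom (𝒢.toSrc_injective e)
  choose M' hM' hM_tgt using fun e => exists_normal_of_hom (𝒢.toTgt_injective e)
  have (e : E) (u : V) := (hM e u).2
  have (e : E) (u : V) := (hM' e u).2
  refine ⟨fun u => ⨅ e, M e u ⊓ M' e u, fun u => ⟨Subgroup.normal_iInf_normal fun e =>
    have := (hM e u).1; have := (hM' e u).1; inferInstance,
    Subgroup.finiteIndex_iInf fun e => inferInstance⟩, fun e => ⟨?_, ?_⟩⟩
  · exact le_bot_iff.1 (hM_src e ▸ Subgroup.comap_mono ((iInf_le _ e).trans inf_le_left))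
  · exact le_bot_iff.1 (hM_tgt e ▸ Subgroup.comap_mono ((iInf_le _ e).trans inf_le_right))

theorem IsSpanningTree.exists_normal_comap_le [Finite V] (hT : 𝒢.IsSpanningTree T)
    (hres : ∀ u, Group.ResiduallyFinite (𝒢.vertexGroup u) ∨
      IsVirtuallyTorsionFree (𝒢.vertexGroup u))
    (H : ∀ u, FinIndexSubgroup (𝒢.vertexGroup u)) :
    ∃ N : Subgroup (𝒢.FundamentalGroup T), N.Normal ∧ N.FiniteIndex ∧
      (∀ u, N.comap (𝒢.of T u) ≤ (H u).1) ∧ ∀ e, N.comap (𝒢.ofEdge T e) = ⊥ := by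
  obtain ⟨M, hM, hM_edge⟩ := 𝒢.exists_normal_comap_toSrc_toTgt_eq_bot hres
  let K (u : V) : Subgroup (𝒢.vertexGroup u) := M u ⊓ (H u).1.normalCore
  have (u : V) : (K u).FiniteIndex := by
    have := (hM u).2
    have := (H u).2
    infer_instance
  have K_normal (u : V) : (K u).Normal := by
    have := (hM u).1
    infer_instance
  have K_src (e : E) : (K (𝒢.src e)).comap (𝒢.toSrc e) = ⊥ :=
    le_bot_iff.1 ((hM_edge e).1 ▸ Subgroup.comap_mono inf_le_left)
  have K_tgt (e : E) : (K (𝒢.tgt e)).comap (𝒢.toTgt e) = ⊥ :=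
    le_bot_iff.1 ((hM_edge e).2 ▸ Subgroup.comap_mono inf_le_left)
  obtain ⟨L, hL, hLK⟩ := hT.exists_comap_conj_eq K
    (fun e b => by rw [Subgroup.Normal.conj_smul_eq_self, K_src])
    (fun e b => by rw [Subgroup.Normal.conj_smul_eq_self, K_tgt])
  have comap_le (u : V) : L.normalCore.comap (𝒢.of T u) ≤ K u := by
    obtain ⟨b, hb⟩ := hLK u 1
    rw [map_one, one_smul, Subgroup.Normal.conj_smul_eq_self] at hb
    exact hb ▸ Subgroup.comap_mono L.normalCore_le
  exact ⟨L.normalCore, inferInstance, inferInstance,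
    fun u => (comap_le u).trans (inf_le_right.trans (Subgroup.normalCore_le _)),
    fun e => le_bot_iff.1 ((Subgroup.comap_mono (comap_le _)).trans_eq (K_src e))⟩

end Separation

section Bounds

namespace IsSpanningTree

variable [Fintype V] [Fintype E] [∀ u, Group.FG (𝒢.vertexGroup u)] [∀ e, Finite (𝒢.edgeGroup e)]

theorem exists_forall_bettiRatio_le (hT : 𝒢.IsSpanningTree T)
    (hres : ∀ u, Group.ResiduallyFinite (𝒢.vertexGroup u) ∨
      IsVirtuallyTorsionFree (𝒢.vertexGroup u))
    {c : V → ℝ} (hc : ∀ u, ∃ H : FinIndexSubgroup (𝒢.vertexGroup u), ∀ K ≤ H,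
      bettiRatio (𝒢.vertexGroup u) K ≤ c u) :
    ∃ H : FinIndexSubgroup (𝒢.FundamentalGroup T), ∀ K ≤ H,
      bettiRatio (𝒢.FundamentalGroup T) K ≤
        ∑ u, c u + ∑ e, 1 / (Nat.card (𝒢.edgeGroup e) : ℝ) := by
  choose H hH using hc
  obtain ⟨N, hN, hNf, hN_of, hN_edge⟩ := hT.exists_normal_comap_le hres H
  refine ⟨⟨N, hNf⟩, ?_⟩
  rintro ⟨K, hKf⟩ (hK : K ≤ N)
  have conj_le (g : 𝒢.FundamentalGroup T) : MulAut.conj g • K ≤ N := conj_smul_le hK g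
  have (g : 𝒢.FundamentalGroup T) : (MulAut.conj g • K).FiniteIndex :=
    ⟨(index_conj_smul g K).trans_ne hKf.index_ne_zero⟩
  obtain ⟨g, hg⟩ := hT.exists_bettiQuotient_le (K := K) fun e g =>
    le_bot_iff.1 ((Subgroup.comap_mono (conj_le g)).trans_eq (hN_edge e))
  refine hg.trans ?_
  gcongr with u
  exact hH u ⟨(MulAut.conj g • K).comap (𝒢.of T u), finiteIndex_comap _ _⟩
    ((Subgroup.comap_mono (conj_le g)).trans (hN_of u))

theorem exists_le_bettiRatio (hT : 𝒢.IsSpanningTree T)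
    (hres : ∀ u, Group.ResiduallyFinite (𝒢.vertexGroup u) ∨
      IsVirtuallyTorsionFree (𝒢.vertexGroup u))
    {c : V → ℝ} (hc : ∀ u (H : FinIndexSubgroup (𝒢.vertexGroup u)), ∃ K ≤ H,
      c u ≤ bettiRatio (𝒢.vertexGroup u) K)
    (H : FinIndexSubgroup (𝒢.FundamentalGroup T)) :
    ∃ K ≤ H, ∑ u, c u + ∑ e, 1 / (Nat.card (𝒢.edgeGroup e) : ℝ) ≤
      bettiRatio (𝒢.FundamentalGroup T) K := by
  obtain ⟨H, hH⟩ := H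
  obtain ⟨N, hN, hNf, -, hN_edge⟩ := hT.exists_normal_comap_le hres fun u => ⟨⊤, inferInstance⟩
  let M := N ⊓ H.normalCore
  have M_edge (e : E) : M.comap (𝒢.ofEdge T e) = ⊥ :=
    le_bot_iff.1 (hN_edge e ▸ Subgroup.comap_mono inf_le_left)
  choose K hKM hK using fun u => hc u ⟨M.comap (𝒢.of T u), finiteIndex_comap _ _⟩
  have := fun u => (K u).2
  have conj_le (u : V) (b : 𝒢.vertexGroup u) : MulAut.conj b • (K u).1 ≤ M.comap (𝒢.of T u) :=
    conj_smul_le (hKM u) b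
  obtain ⟨L, hL, hLK⟩ := hT.exists_comap_conj_eq (fun u => (K u).1)
    (fun e b => le_bot_iff.1 ((Subgroup.comap_mono (conj_le _ b)).trans_eq (M_edge e)))
    (fun e b => le_bot_iff.1 ((Subgroup.comap_mono (conj_le _ b)).trans_eq
      (comap_toTgt_eq_bot (M_edge e))))
  refine ⟨⟨L ⊓ M, inferInstance⟩, inf_le_right.trans (inf_le_right.trans H.normalCore_le), ?_⟩
  have conj_eq (g : 𝒢.FundamentalGroup T) : MulAut.conj g • (L ⊓ M) = MulAut.conj g • L ⊓ M := by
    rw [Subgroup.smul_inf, Subgroup.Normal.conj_smul_eq_self g M]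
  obtain ⟨g, hg⟩ := hT.exists_le_bettiQuotient (K := L ⊓ M) fun e g =>
    le_bot_iff.1 ((Subgroup.comap_mono ((conj_eq g).trans_le inf_le_right)).trans_eq (M_edge e))
  refine le_trans ?_ hg
  gcongr with u
  obtain ⟨b, hb⟩ := hLK u g
  rw [conj_eq, Subgroup.comap_inf, hb, inf_eq_left.2 (conj_le u b), bettiQuotient_conj_smul]
  exact hK u

end IsSpanningTree

end Bounds

end GraphOfGroups

end

theorem corollary3p10 {V : Type*} {E : Type*} [Fintype V] [Fintype E]
    (𝒢 : GraphOfGroups V E) (T : Set E) (hT : 𝒢.IsSpanningTree T)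
    (hfg : ∀ u, Group.FG (𝒢.vertexGroup u))
    (hfin : ∀ e, Finite (𝒢.edgeGroup e))
    (hres : ∀ u, Group.ResiduallyFinite (𝒢.vertexGroup u) ∨
      IsVirtuallyTorsionFree (𝒢.vertexGroup u)) :
    bettiVolume (𝒢.FundamentalGroup T) =
      (∑ u, bettiVolume (𝒢.vertexGroup u)) + ∑ e, 1 / (Nat.card (𝒢.edgeGroup e) : ℝ) := by
  have hV : (0 : ℝ) < Fintype.card V := by
    rw [← Nat.card_eq_fintype_card, ← hT.ncard_add_one]
    positivity
  have sum_const_add (ε : ℝ) (f : V → ℝ) (r : ℝ) :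
      ∑ u, (f u + ε / Fintype.card V) + r = ∑ u, f u + r + ε := by
    rw [Finset.sum_add_distrib, Finset.sum_const, Finset.card_univ, nsmul_eq_mul,
      mul_div_cancel₀ _ hV.ne', add_right_comm]
  refine bettiVolume_eq_of_forall _ (fun ε hε => ?_) fun ε hε H => ?_
  · rw [← sum_const_add]
    exact hT.exists_forall_bettiRatio_le hres fun u =>
      exists_forall_bettiRatio_le (div_pos hε hV)
  · rw [sub_eq_add_neg, ← sum_const_add]
    refine hT.exists_le_bettiRatio hres (fun u K => ?_) H
    rw [neg_div, ← sub_eq_add_neg]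
    exact exists_le_bettiRatio (div_pos hε hV) K
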